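/- Let $A$ be a (not necessarily unital) $C^*$-algebra and let $X$ be a Hilbert $A$-bimodule: $X$ is a right Hilbert $A$-module (a Banach space with a right action of $A$ and an $A$-valued inner product $\langle\cdot,\cdot\rangle_X$, linear in the second variable, with $\langle\xi,\eta a\rangle_X=\langle\xi,\eta\rangle_X a$, $\langle\xi,\eta\rangle_X=\langle\eta,\xi\rangle_X^*$, $\langle\xi,\xi\rangle_X\ge 0$ and $\|\xi\|^2=\|\langle\xi,\xi\rangle_X\|$), together with a $*$-homomorphism $\varphi_X:A\to\mathcal L(X)$ into the adjointable operators and a left inner product ${}_X\langle\cdot,\cdot\rangle:X\times X\to A$, linear in the first variable, such that ${}_X\langle\varphi_X(a)\xi,\eta\rangle=a\,{}_X\langle\xi,\eta\rangle$, ${}_X\langle\xi,\eta\rangle={}_X\langle\eta,\xi\rangle^*$, ${}_X\langle\xi,\xi\rangle\ge 0$ and $\varphi_X({}_X\langle\xi,\eta\rangle)\zeta=\xi\langle\eta,\zeta\rangle_X$ for all $a\in A$, $\xi,\eta,\zeta\in X$. Forgetting the left inner product, $X$ is a $C^*$-correspondence over $A$. Let $\theta_{\xi,\eta}(\zeta)=\xi\langle\eta,\zeta\rangle_X$,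 let $\mathcal K(X)$ be the closed linear span of the $\theta_{\xi,\eta}$, let $J_X=\varphi_X^{-1}(\mathcal K(X))\cap(\ker\varphi_X)^\perp$, where $I^\perp=\{a\in A\mid ab=0\text{ for all }b\in I\}$, and let $I_X$ be the closed linear span of the elements ${}_X\langle\xi,\eta\rangle$. A representation of the $C^*$-correspondence $X$ on a $C^*$-algebra $B$ is a pair $(\pi,t)$ of a $*$-homomorphism $\pi:A\to B$ and a linear map $t:X\to B$ with $t(\xi)^*t(\eta)=\pi(\langle\xi,\eta\rangle_X)$ and $\pi(a)t(\xi)=t(\varphi_X(a)\xi)$; let $\psi_t:\mathcal K(X)\to B$ be the $*$-homomorphism with $\psi_t(\theta_{\xi,\eta})=t(\xi)t(\eta)^*$. It satisfies Condition $(*)$ if $\pi(a)=\psi_t(\varphi_X(a))$ for all $a\in J_X$. The $C^*$-algebra $\mathcal O_X$ is the one generated by the universal representation $(\pi_X,t_X)$ of $X$ satisfying Condition $(*)$. A covariant representation of the Hilbert $A$-bimodule $X$ on $B$ is a pair $(\pi,t)$ of a $*$-homomorphism $\pi:A\to B$ and a linear map $t:X\to B$ with $t(\varphi_X(a)\xi)=\pi(a)t(\xi)$,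 $t(\xi a)=t(\xi)\pi(a)$, $\pi({}_X\langle\xi,\eta\rangle)=t(\xi)t(\eta)^*$ and $\pi(\langle\xi,\eta\rangle_X)=t(\xi)^*t(\eta)$. The crossed product $A\rtimes_X\mathbb Z$ is the $C^*$-algebra generated by the universal covariant representation $(\pi^{\rm cov},t^{\rm cov})$ of $X$. Then both universal $C^*$-algebras exist, and $A\rtimes_X\mathbb Z$ is canonically isomorphic to $\mathcal O_X$: there is a unique $*$-isomorphism $\Phi:A\rtimes_X\mathbb Z\to\mathcal O_X$ with $\Phi\circ\pi^{\rm cov}=\pi_X$ and $\Phi\circ t^{\rm cov}=t_X$. Moreover $J_X=I_X$, and a representation $(\pi,t)$ of the $C^*$-correspondence $X$ satisfies $\pi({}_X\langle\xi,\eta\rangle)=t(\xi)t(\eta)^*$ for all $\xi,\eta\in X$ if and only if it satisfies Condition $(*)$. -/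

import Mathlib

open MulOpposite

universe u v w

noncomputable section

namespace HilbertBimod

set_option linter.unusedSectionVars false

section Module

variable {A : Type u} {X : Type v} [NonUnitalCStarAlgebra A] [PartialOrder A] [StarOrderedRing A]
  [NormedAddCommGroup X] [NormedSpace ℂ X] [SMul Aᵐᵒᵖ X] [CStarModule Aᵐᵒᵖ X]

/-!
A right Hilbert `A`-module is a Banach space `X` with an instance `CStarModule Aᵐᵒᵖ X`.
Mathlib's class `CStarModule R X` asks for `⟪ξ, r • η⟫ = r * ⟪ξ, η⟫`; over the opposite algebra
this reads `⟨ξ, η a⟩ = ⟨ξ, η⟩ a`, where `η a` is `op a • η` and `⟨ξ, η⟩` is `unop ⟪ξ, η⟫`.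
Additivity and associativity of the right action follow from definiteness of the inner product.
-/

/-- The right action `ξ a` of `a : A` on `ξ : X`. -/
def ract (ξ : X) (a : A) : X := op a • ξ

variable (A) in
/-- The `A`-valued right inner product `⟨ξ, η⟩`, linear in the second variable. -/
def rinner (ξ η : X) : A := unop (inner Aᵐᵒᵖ ξ η)

theorem rinner_ract (ξ η : X) (a : A) : rinner A ξ (ract η a) = rinner A ξ η * a := by
  simp [rinner, ract]

theorem star_rinner (ξ η : X) : star (rinner A ξ η) = rinner A η ξ := by
  simp [rinner, ← unop_star]

theorem rinner_add (ξ η ζ : X) : rinner A ξ (η + ζ) = rinner A ξ η + rinner A ξ ζ := by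
  simp [rinner]

theorem rinner_smul (c : ℂ) (ξ η : X) : rinner A ξ (c • η) = c • rinner A ξ η := by
  simp [rinner]

theorem rinner_add_left (ξ η ζ : X) : rinner A (ξ + η) ζ = rinner A ξ ζ + rinner A η ζ := by
  simp [rinner]

theorem norm_sq_eq (ξ : X) : ‖ξ‖ ^ 2 = ‖rinner A ξ ξ‖ := CStarModule.norm_sq_eq Aᵐᵒᵖ

theorem norm_rinner_le (ξ η : X) : ‖rinner A ξ η‖ ≤ ‖ξ‖ * ‖η‖ :=
  CStarModule.norm_inner_le (A := Aᵐᵒᵖ) X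

variable (A) in
theorem ext_rinner {ξ η : X} (h : ∀ ζ : X, rinner A ζ ξ = rinner A ζ η) : ξ = η := by
  have h1 : ∀ ζ : X, inner Aᵐᵒᵖ ζ (ξ - η) = 0 := fun ζ => by
    rw [CStarModule.inner_sub_right, sub_eq_zero]
    exact unop_injective (h ζ)
  exact sub_eq_zero.1 (CStarModule.inner_self.1 (h1 (ξ - η)))

theorem norm_ract_le (ξ : X) (a : A) : ‖ract ξ a‖ ≤ ‖ξ‖ * ‖a‖ := by
  have h : ‖ract ξ a‖ ^ 2 ≤ (‖ξ‖ * ‖a‖) ^ 2 := by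
    have e : rinner A (ract ξ a) (ract ξ a) = star a * rinner A ξ ξ * a := by
      rw [rinner_ract, ← star_rinner, rinner_ract, star_mul, star_rinner]
    rw [norm_sq_eq (A := A), e]
    calc ‖star a * rinner A ξ ξ * a‖ ≤ ‖star a‖ * ‖rinner A ξ ξ‖ * ‖a‖ :=
          (norm_mul_le _ _).trans (by gcongr; exact norm_mul_le _ _)
      _ = (‖ξ‖ * ‖a‖) ^ 2 := by rw [norm_star, ← norm_sq_eq]; ring
  exact (pow_le_pow_iff_left₀ (norm_nonneg _) (by positivity) two_ne_zero).1 h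

variable (A) in
/-- The operator `θ_{ξ,η} : ζ ↦ ξ ⟨η, ζ⟩`. -/
def theta (ξ η : X) : X →L[ℂ] X :=
  LinearMap.mkContinuous
    { toFun := fun ζ => ract ξ (rinner A η ζ)
      map_add' := fun ζ ζ' => ext_rinner A fun x => by
        simp only [rinner_ract, rinner_add, mul_add]
      map_smul' := fun c ζ => ext_rinner A fun x => by
        simp only [rinner_ract, rinner_smul, mul_smul_comm, RingHom.id_apply] }
    (‖ξ‖ * ‖η‖) fun ζ =>
      (norm_ract_le ξ (rinner A η ζ)).trans (by
        rw [mul_assoc]; gcongr; exact norm_rinner_le η ζ)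

theorem theta_apply (ξ η ζ : X) : theta A ξ η ζ = ract ξ (rinner A η ζ) := rfl

variable (A X) in
/-- `K(X)`, the closed linear span of the operators `θ_{ξ,η}`. The norm of the algebra `L(X)` of
adjointable operators is the operator norm and `L(X)` is closed, so that the closure may be taken
among all bounded operators. -/
def compacts : Submodule ℂ (X →L[ℂ] X) :=
  (Submodule.span ℂ (Set.range fun p : X × X => theta A p.1 p.2)).topologicalClosure

theorem theta_mem_compacts (ξ η : X) : theta A ξ η ∈ compacts A X :=
  Submodule.le_topologicalClosure _ (Submodule.subset_span ⟨(ξ, η), rfl⟩)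

end Module

section Defs

variable (A : Type u) (X : Type v) [NonUnitalCStarAlgebra A] [PartialOrder A] [StarOrderedRing A]
  [NormedAddCommGroup X] [NormedSpace ℂ X] [SMul Aᵐᵒᵖ X] [CStarModule Aᵐᵒᵖ X]

/-- The structure of a C*-correspondence over `A` on the Hilbert `A`-module `X`: a
`*`-homomorphism from `A` to the adjointable operators, that is, an algebra homomorphism `φ` such
that each `φ a` is adjointable with adjoint `φ (a*)`. -/
structure Correspondence where
  φ : A →ₙₐ[ℂ] (X →L[ℂ] X)
  adjoint : ∀ (a : A) (ξ η : X), rinner A (φ a ξ) η = rinner A ξ (φ (star a) η)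

/-- The structure of a Hilbert `A`-bimodule on the Hilbert `A`-module `X`. -/
structure Bimodule extends Correspondence A X where
  /-- The left inner product, linear in the first variable. -/
  linner : X → X → A
  linner_add : ∀ ξ η ζ : X, linner (ξ + η) ζ = linner ξ ζ + linner η ζ
  linner_smul : ∀ (c : ℂ) (ξ η : X), linner (c • ξ) η = c • linner ξ η
  linner_act : ∀ (a : A) (ξ η : X), linner (φ a ξ) η = a * linner ξ η
  star_linner : ∀ ξ η : X, linner ξ η = star (linner η ξ)
  linner_nonneg : ∀ ξ : X, 0 ≤ linner ξ ξ
  compat : ∀ ξ η ζ : X, φ (linner ξ η) ζ = ract ξ (rinner A η ζ)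

end Defs

section Ideals

variable {A : Type u} {X : Type v} [NonUnitalCStarAlgebra A] [PartialOrder A] [StarOrderedRing A]
  [NormedAddCommGroup X] [NormedSpace ℂ X] [SMul Aᵐᵒᵖ X] [CStarModule Aᵐᵒᵖ X]

/-- `I^⊥ = {a | a b = 0 for all b ∈ I}`. -/
def perp (I : Set A) : Set A := {a | ∀ b ∈ I, a * b = 0}

/-- `J_X = φ⁻¹(K(X)) ∩ (ker φ)^⊥`. -/
def Correspondence.J (C : Correspondence A X) : Set A :=
  {a | C.φ a ∈ compacts A X} ∩ perp {b | C.φ b = 0}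

/-- `I_X`, the closed linear span of the values of the left inner product. -/
def Bimodule.I (H : Bimodule A X) : Set A :=
  ((Submodule.span ℂ (Set.range fun p : X × X => H.linner p.1 p.2)).topologicalClosure : Set A)

/-- A representation of a C*-correspondence on a C*-algebra `B`. -/
structure Representation (C : Correspondence A X) (B : Type w) [NonUnitalCStarAlgebra B] where
  π : A →⋆ₙₐ[ℂ] B
  t : X →ₗ[ℂ] B
  inner_eq : ∀ ξ η : X, star (t ξ) * t η = π (rinner A ξ η)
  act_eq : ∀ (a : A) (ξ : X), π a * t ξ = t (C.φ a ξ)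

/-- A covariant representation of a Hilbert bimodule on a C*-algebra `B`. -/
structure CovariantRepresentation (H : Bimodule A X) (B : Type w) [NonUnitalCStarAlgebra B] where
  π : A →⋆ₙₐ[ℂ] B
  t : X →ₗ[ℂ] B
  left_act : ∀ (a : A) (ξ : X), t (H.φ a ξ) = π a * t ξ
  right_act : ∀ (ξ : X) (a : A), t (ract ξ a) = t ξ * π a
  left_inner : ∀ ξ η : X, π (H.linner ξ η) = t ξ * star (t η)
  right_inner : ∀ ξ η : X, π (rinner A ξ η) = star (t ξ) * t η

/-- `C*(π, t)`, the C*-subalgebra of `B` generated by the images of `π` and `t`. -/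
def generated {B : Type w} [NonUnitalCStarAlgebra B] (π : A →⋆ₙₐ[ℂ] B) (t : X →ₗ[ℂ] B) :
    NonUnitalStarSubalgebra ℂ B :=
  (NonUnitalStarAlgebra.adjoin ℂ (Set.range π ∪ Set.range t)).topologicalClosure

/-- A bounded assignment of values to a family of vectors extends uniquely to a continuous linear
map on the closed linear span of the family. -/
theorem existsUnique_extension {ι E F : Type*} [NormedAddCommGroup E] [NormedSpace ℂ E]
    [NormedAddCommGroup F] [NormedSpace ℂ F] [CompleteSpace F] (f : ι → E) (g : ι → F)
    (h : ∀ c : ι →₀ ℂ,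
      ‖Finsupp.linearCombination ℂ g c‖ ≤ ‖Finsupp.linearCombination ℂ f c‖) :
    ∃! ψ : (Submodule.span ℂ (Set.range f)).topologicalClosure →L[ℂ] F,
      ∀ (i : ι) (hi : f i ∈ (Submodule.span ℂ (Set.range f)).topologicalClosure),
        ψ ⟨f i, hi⟩ = g i := by
  have hmem : ∀ i, f i ∈ (Submodule.span ℂ (Set.range f)).topologicalClosure := fun i =>
    Submodule.le_topologicalClosure _ (Submodule.subset_span ⟨i, rfl⟩)
  let e : (ι →₀ ℂ) →ₗ[ℂ] (Submodule.span ℂ (Set.range f)).topologicalClosure :=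
    Finsupp.linearCombination ℂ fun i => ⟨f i, hmem i⟩
  have he : ∀ c, ((e c : _) : E) = Finsupp.linearCombination ℂ f c := fun c => by
    simp [e, Finsupp.linearCombination_apply, Finsupp.sum]
  have hd : DenseRange e := by
    intro x
    rw [closure_subtype]
    have hx : (x : E) ∈ closure (Submodule.span ℂ (Set.range f) : Set E) := x.2
    refine closure_mono ?_ hx
    intro y hy
    obtain ⟨c, rfl⟩ := (Finsupp.mem_span_range_iff_exists_finsupp).1 hy
    exact ⟨e c, ⟨c, rfl⟩, he c⟩
  have hb : ∃ K : ℝ, ∀ c, ‖Finsupp.linearCombination ℂ g c‖ ≤ K * ‖e c‖ :=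
    ⟨1, fun c => by rw [one_mul, Submodule.coe_norm, he]; exact h c⟩
  refine ⟨(Finsupp.linearCombination ℂ g).extendOfNorm e, ?_, ?_⟩
  · intro i hi
    have := LinearMap.extendOfNorm_eq hd hb (Finsupp.single i 1)
    simpa [e] using this
  · intro ψ hψ
    ext x
    have hc : Set.EqOn ψ ((Finsupp.linearCombination ℂ g).extendOfNorm e) (Set.range e) := by
      rintro _ ⟨c, rfl⟩
      rw [LinearMap.extendOfNorm_eq hd hb]
      simp only [e, Finsupp.linearCombination_apply, Finsupp.sum, map_sum, map_smul, hψ]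
    exact congrFun (Continuous.ext_on hd ψ.continuous (ContinuousLinearMap.continuous _) hc) x

namespace Representation

variable {C : Correspondence A X} {B : Type w} [NonUnitalCStarAlgebra B]

theorem t_ract (R : Representation C B) (ξ : X) (a : A) : R.t (ract ξ a) = R.t ξ * R.π a := by
  have hl : ∀ η : X, star (R.t η) * (R.t (ract ξ a) - R.t ξ * R.π a) = 0 := fun η => by
    rw [mul_sub, ← mul_assoc, R.inner_eq, R.inner_eq, rinner_ract, map_mul, sub_self]
  have h : star (R.t (ract ξ a) - R.t ξ * R.π a) * (R.t (ract ξ a) - R.t ξ * R.π a) = 0 := by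
    rw [star_sub, star_mul, sub_mul, mul_assoc, hl, hl, mul_zero, sub_zero]
  exact sub_eq_zero.1 ((CStarRing.star_mul_self_eq_zero_iff _).1 h)

theorem norm_t_le (R : Representation C B) (ξ : X) : ‖R.t ξ‖ ≤ ‖ξ‖ := by
  have h : ‖R.t ξ‖ ^ 2 ≤ ‖ξ‖ ^ 2 := by
    rw [sq, ← CStarRing.norm_star_mul_self, R.inner_eq, norm_sq_eq (A := A)]
    exact NonUnitalStarAlgHom.norm_apply_le R.π _
  exact (pow_le_pow_iff_left₀ (norm_nonneg _) (norm_nonneg _) two_ne_zero).1 h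

/-- The estimate which shows that `ψ_t` is well defined. -/
theorem norm_sum_le (R : Representation C B) (c : X × X →₀ ℂ) :
    ‖Finsupp.linearCombination ℂ (fun p : X × X => R.t p.1 * star (R.t p.2)) c‖ ≤
      ‖Finsupp.linearCombination ℂ (fun p : X × X => theta A p.1 p.2) c‖ := by
  rw [Finsupp.linearCombination_apply, Finsupp.linearCombination_apply, Finsupp.sum, Finsupp.sum]
  set S : B := ∑ p ∈ c.support, c p • (R.t p.1 * star (R.t p.2)) with hS
  set K : X →L[ℂ] X := ∑ p ∈ c.support, c p • theta A p.1 p.2 with hK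
  set K' : X →L[ℂ] X := ∑ p ∈ c.support, star (c p) • theta A p.2 p.1 with hK'
  have hSt : ∀ ζ, S * R.t ζ = R.t (K ζ) := fun ζ => by
    simp only [hS, hK, Finset.sum_mul, sum_apply, map_sum, smul_mul_assoc,
      mul_assoc, R.inner_eq, smul_apply, map_smul, theta_apply, t_ract]
  have hSt' : ∀ ζ, star S * R.t ζ = R.t (K' ζ) := fun ζ => by
    simp only [hS, hK', star_sum, star_smul, star_mul, star_star, Finset.sum_mul,
      sum_apply, map_sum, smul_mul_assoc,
      mul_assoc, R.inner_eq, smul_apply, map_smul, theta_apply, t_ract]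
  have hadj : ∀ ξ η : X, rinner A (K' ξ) η = rinner A ξ (K η) := fun ξ η => by
    simp only [hK, hK', rinner, sum_apply, smul_apply,
      CStarModule.inner_sum_left, CStarModule.inner_sum_right, CStarModule.inner_smul_left_complex,
      CStarModule.inner_smul_right_complex, star_star, theta_apply, ract,
      CStarModule.inner_op_smul_left, CStarModule.inner_op_smul_right]
    refine congrArg unop (Finset.sum_congr rfl fun p _ => ?_)
    simp only [op_unop, CStarModule.star_inner]
  have hK'le : ∀ ξ, ‖K' ξ‖ ≤ ‖K‖ * ‖ξ‖ := fun ξ => by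
    by_cases h0 : ‖K' ξ‖ = 0
    · rw [h0]; positivity
    have h1 : ‖K' ξ‖ * ‖K' ξ‖ ≤ (‖K‖ * ‖ξ‖) * ‖K' ξ‖ := by
      rw [← sq, norm_sq_eq (A := A), hadj]
      calc ‖rinner A ξ (K (K' ξ))‖ ≤ ‖ξ‖ * ‖K (K' ξ)‖ := norm_rinner_le _ _
        _ ≤ ‖ξ‖ * (‖K‖ * ‖K' ξ‖) := by gcongr; exact K.le_opNorm _
        _ = _ := by ring
    exact le_of_mul_le_mul_right h1 (lt_of_le_of_ne (norm_nonneg _) (Ne.symm h0))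
  let p : Unitization ℂ B := ((S * star S : B) : Unitization ℂ B)
  have hp : IsSelfAdjoint p := by
    change star p = p
    simp [p, ← Unitization.inr_star]
  have hpn : ∀ (n : ℕ) (ζ : X), ∃ ζ' : X, ‖ζ'‖ ≤ (‖K‖ ^ 2) ^ n * ‖ζ‖ ∧
      p ^ n * (R.t ζ : Unitization ℂ B) = (R.t ζ' : Unitization ℂ B) := by
    intro n
    induction n with
    | zero => exact fun ζ => ⟨ζ, by simp, by simp⟩
    | succ n ih =>
      intro ζ
      obtain ⟨ζ', h1, h2⟩ := ih ζ
      refine ⟨K (K' ζ'), ?_, ?_⟩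
      · calc ‖K (K' ζ')‖ ≤ ‖K‖ * (‖K‖ * ‖ζ'‖) :=
              (K.le_opNorm _).trans (by gcongr; exact hK'le _)
          _ ≤ ‖K‖ * (‖K‖ * ((‖K‖ ^ 2) ^ n * ‖ζ‖)) := by gcongr
          _ = _ := by ring
      · rw [pow_succ', mul_assoc, h2]
        simp only [p]
        rw [← Unitization.inr_mul, mul_assoc, hSt', hSt]
  set D : ℝ := ∑ q ∈ c.support, ‖c q‖ * (‖q.1‖ * ‖q.2‖) with hD
  have hbd : ∀ n : ℕ, ‖p ^ n * (S : Unitization ℂ B)‖ ≤ (‖K‖ ^ 2) ^ n * D := fun n => by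
    have e : p ^ n * (S : Unitization ℂ B) = ∑ q ∈ c.support,
        c q • (p ^ n * (R.t q.1 : Unitization ℂ B) * (star (R.t q.2) : B)) := by
      have : (S : Unitization ℂ B) = ∑ q ∈ c.support,
          c q • ((R.t q.1 : Unitization ℂ B) * ((star (R.t q.2) : B) : Unitization ℂ B)) := by
        have := map_sum (Unitization.inrHom ℂ ℂ B)
          (fun q : X × X => c q • (R.t q.1 * star (R.t q.2))) c.support
        simp only [Unitization.inrHom_apply, Unitization.inr_smul, Unitization.inr_mul] at this
        rw [hS]
        exact this
      rw [this, Finset.mul_sum]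
      refine Finset.sum_congr rfl fun q _ => ?_
      rw [mul_smul_comm, mul_assoc]
    rw [e, hD, Finset.mul_sum]
    refine (_root_.norm_sum_le _ _).trans (Finset.sum_le_sum fun q _ => ?_)
    obtain ⟨ζ', h1, h2⟩ := hpn n q.1
    rw [h2, norm_smul, ← Unitization.inr_mul, Unitization.norm_inr]
    calc ‖c q‖ * ‖R.t ζ' * star (R.t q.2)‖
        ≤ ‖c q‖ * (((‖K‖ ^ 2) ^ n * ‖q.1‖) * ‖q.2‖) := by
          gcongr
          refine (norm_mul_le _ _).trans ?_
          rw [norm_star]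
          exact mul_le_mul ((R.norm_t_le _).trans h1) (R.norm_t_le _) (norm_nonneg _)
            (by positivity)
      _ = _ := by ring
  by_contra hlt
  rw [not_le] at hlt
  have hS0 : 0 < ‖S‖ := (norm_nonneg _).trans_lt hlt
  have hpS : ‖p‖ = ‖S‖ ^ 2 := by
    simp only [p]
    rw [Unitization.norm_inr, CStarRing.norm_self_mul_star, sq]
  have key : ∀ k : ℕ, ‖S‖ ^ 2 ≤ D * ‖S‖ * ((‖K‖ ^ 2) / (‖S‖ ^ 2)) ^ (2 ^ k - 1) := fun k => by
    have h1 : ‖p ^ (2 ^ k)‖ = (‖S‖ ^ 2) ^ (2 ^ k) := by rw [hp.norm_pow_two_pow, hpS]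
    have h2 : 2 ^ k = (2 ^ k - 1) + 1 := (Nat.sub_add_cancel Nat.one_le_two_pow).symm
    have h3 : ‖p ^ (2 ^ k)‖ ≤ (‖K‖ ^ 2) ^ (2 ^ k - 1) * D * ‖S‖ := by
      have e : p ^ (2 ^ k) = p ^ (2 ^ k - 1) * (S : Unitization ℂ B) *
          ((star S : B) : Unitization ℂ B) := by
        conv_lhs => rw [h2, pow_succ]
        simp [p, mul_assoc]
      rw [e]
      refine (norm_mul_le _ _).trans ?_
      rw [Unitization.norm_inr (a := star S), norm_star]
      gcongr
      exact hbd _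
    rw [h1] at h3
    conv_lhs at h3 => rw [h2, pow_succ]
    rw [div_pow, ← mul_div_assoc, le_div_iff₀ (by positivity)]
    linarith
  have hlim : Filter.Tendsto (fun k : ℕ => D * ‖S‖ * ((‖K‖ ^ 2) / (‖S‖ ^ 2)) ^ (2 ^ k - 1))
      Filter.atTop (nhds (D * ‖S‖ * 0)) := by
    refine Filter.Tendsto.const_mul _ ?_
    refine (tendsto_pow_atTop_nhds_zero_of_lt_one (by positivity) ?_).comp ?_
    · rw [div_lt_one (by positivity)]
      gcongr
    · refine Filter.tendsto_atTop_mono (fun k => ?_) Filter.tendsto_id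
      exact Nat.le_sub_one_of_lt Nat.lt_two_pow_self
  have := ge_of_tendsto' hlim key
  rw [mul_zero] at this
  nlinarith

theorem existsUnique_psi (R : Representation C B) :
    ∃! ψ : compacts A X →L[ℂ] B, ∀ ξ η : X,
      ψ ⟨theta A ξ η, theta_mem_compacts ξ η⟩ = R.t ξ * star (R.t η) := by
  obtain ⟨ψ, h1, h2⟩ := existsUnique_extension (fun p : X × X => theta A p.1 p.2)
    (fun p : X × X => R.t p.1 * star (R.t p.2)) R.norm_sum_le
  exact ⟨ψ, fun ξ η => h1 (ξ, η) _, fun ψ' h => h2 ψ' fun p _ => h p.1 p.2⟩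

/-- The map `ψ_t : K(X) → B`, the unique continuous linear map with
`ψ_t(θ_{ξ,η}) = t(ξ) t(η)*`; it is automatically a `*`-homomorphism. -/
def psi (R : Representation C B) : compacts A X →L[ℂ] B := R.existsUnique_psi.choose

theorem psi_theta (R : Representation C B) (ξ η : X) :
    R.psi ⟨theta A ξ η, theta_mem_compacts ξ η⟩ = R.t ξ * star (R.t η) :=
  R.existsUnique_psi.choose_spec.1 ξ η

/-- Condition (*): `π(a) = ψ_t(φ(a))` for all `a ∈ J_X`. -/
def ConditionStar (R : Representation C B) : Prop :=
  ∀ (a : A) (ha : a ∈ C.J), R.π a = R.psi ⟨C.φ a, ha.1⟩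

/-- `B` together with `R` is the C*-algebra `O_X` with the universal representation `(π_X, t_X)`
satisfying Condition (*). -/
structure IsCuntzPimsner (R : Representation C B) : Prop where
  conditionStar : R.ConditionStar
  generated_eq_top : generated R.π R.t = ⊤
  universal : ∀ (D : Type w) [NonUnitalCStarAlgebra D] (S : Representation C D),
    S.ConditionStar → ∃ ρ : B →⋆ₙₐ[ℂ] D,
      (∀ a, ρ (R.π a) = S.π a) ∧ ∀ ξ, ρ (R.t ξ) = S.t ξ

end Representation

/-- `B` together with `R` is the crossed product `A ⋊_X ℤ` with its universal covariant
representation. -/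
structure CovariantRepresentation.IsCrossedProduct {H : Bimodule A X} {B : Type w}
    [NonUnitalCStarAlgebra B] (R : CovariantRepresentation H B) : Prop where
  generated_eq_top : generated R.π R.t = ⊤
  universal : ∀ (D : Type w) [NonUnitalCStarAlgebra D] (S : CovariantRepresentation H D),
    ∃ ρ : B →⋆ₙₐ[ℂ] D, (∀ a, ρ (R.π a) = S.π a) ∧ ∀ ξ, ρ (R.t ξ) = S.t ξ

end Ideals

end HilbertBimod

end

/-! The identity `φ_linner` says that the left action carries the generators of $I_X$ to those of
$\mathcal K(X)$. Left inner products annihilate $\ker\varphi_X$, so $I_X\subseteq J_X$. For the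
converse one needs $\varphi_X(I_X)=\mathcal K(X)$ (`exists_φ_eq`): given $a\in J_X$, choose $b\in
I_X$ with $\varphi_X(b)=\varphi_X(a)$; then $a-b\in\ker\varphi_X\cap(\ker\varphi_X)^\perp=0$. The
image of $I_X$ contains every $\theta_{\xi,\eta}$, so it is enough that it be closed, and this
follows from $\|a\|\le\|\varphi_X(a)\|$ on $I_X$ (`norm_le_norm_φ`). That bound comes from
continuity of the left inner product in its first variable (closed graph theorem) and a spectral
radius argument (`norm_le_norm_φ_of_bound`).

Both $\pi$ and $\psi_t\circ\varphi_X$ are continuous and linear on $J_X=I_X$, so Condition (*) need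
only be tested on left inner products, where it is the relation
$\pi({}_X\langle\xi,\eta\rangle)=t(\xi)t(\eta)^*$. Hence covariant representations and
representations with Condition (*) are the same objects and have the same universal algebra. It is
built from the covariance relations, which are $*$-polynomial identities in the generators
(`exists_universal`). -/

namespace HilbertBimod

set_option linter.unusedSectionVars false

open scoped ENNReal

/-! ### Universal C*-algebras of families of generators with relations -/

/-- Formal non-unital `*`-polynomials in the generators `G`. -/
inductive StarPoly (G : Type w) : Type w
  | zero : StarPoly G
  | gen : G → StarPoly G
  | add : StarPoly G → StarPoly G → StarPoly G
  | mul : StarPoly G → StarPoly G → StarPoly G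
  | smul : ℂ → StarPoly G → StarPoly G
  | star : StarPoly G → StarPoly G

/-- The value of a formal `*`-polynomial at a family of elements of a C*-algebra. -/
noncomputable def StarPoly.eval {G : Type w} {B : Type*} [NonUnitalCStarAlgebra B] (f : G → B) :
    StarPoly G → B
  | zero => 0
  | gen g => f g
  | add p q => p.eval f + q.eval f
  | mul p q => p.eval f * q.eval f
  | smul c p => c • p.eval f
  | star p => Star.star (p.eval f)

theorem StarPoly.map_eval {G : Type w} {B D : Type*} [NonUnitalCStarAlgebra B]
    [NonUnitalCStarAlgebra D] (ρ : B →⋆ₙₐ[ℂ] D) (f : G → B) (p : StarPoly G) :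
    ρ (p.eval f) = p.eval (fun g => ρ (f g)) := by
  induction p with
  | zero => simp [eval]
  | gen g => rfl
  | add p q hp hq => simp [eval, hp, hq]
  | mul p q hp hq => simp [eval, hp, hq]
  | smul c p hp => simp [eval, hp]
  | star p hp => simp [eval, hp, map_star]

theorem StarPoly.exists_eval_eq {G : Type w} {B : Type*} [NonUnitalCStarAlgebra B] (f : G → B)
    {x : B} (hx : x ∈ NonUnitalStarAlgebra.adjoin ℂ (Set.range f)) :
    ∃ p : StarPoly G, p.eval f = x := by
  induction hx using NonUnitalStarAlgebra.adjoin_induction with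
  | mem x hx => obtain ⟨g, rfl⟩ := hx; exact ⟨gen g, rfl⟩
  | add x y _ _ hx hy =>
    obtain ⟨p, rfl⟩ := hx; obtain ⟨q, rfl⟩ := hy; exact ⟨p.add q, rfl⟩
  | zero => exact ⟨zero, rfl⟩
  | mul x y _ _ hx hy =>
    obtain ⟨p, rfl⟩ := hx; obtain ⟨q, rfl⟩ := hy; exact ⟨p.mul q, rfl⟩
  | smul c x _ hx => obtain ⟨p, rfl⟩ := hx; exact ⟨p.smul c, rfl⟩
  | star x _ hx => obtain ⟨p, rfl⟩ := hx; exact ⟨p.star, rfl⟩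

/-- A family of elements dominated in norm, on all `*`-polynomials, by a generating family is the
image of the latter under a `*`-homomorphism. -/
theorem exists_starHom_of_norm_eval_le {G : Type w} {B D : Type*} [NonUnitalCStarAlgebra B]
    [NonUnitalCStarAlgebra D] (f : G → B) (g : G → D)
    (hf : (NonUnitalStarAlgebra.adjoin ℂ (Set.range f)).topologicalClosure = ⊤)
    (h : ∀ p : StarPoly G, ‖p.eval g‖ ≤ ‖p.eval f‖) :
    ∃ ρ : B →⋆ₙₐ[ℂ] D, ∀ x, ρ (f x) = g x := by
  -- `S` will be the graph of the required homomorphism. The product carries the sup norm, so the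
  -- domination hypothesis makes the first projection isometric on `S`.
  let S : NonUnitalStarSubalgebra ℂ (B × D) :=
    (NonUnitalStarAlgebra.adjoin ℂ (Set.range fun x => (f x, g x))).topologicalClosure
  have hS : IsClosed (S : Set (B × D)) := NonUnitalStarSubalgebra.isClosed_topologicalClosure _
  have hmem : ∀ x, (f x, g x) ∈ S := fun x =>
    NonUnitalStarSubalgebra.le_topologicalClosure _
      (NonUnitalStarAlgebra.subset_adjoin ℂ _ ⟨x, rfl⟩)
  have hle : ∀ z ∈ S, ‖z.2‖ ≤ ‖z.1‖ := by
    have hc : IsClosed {z : B × D | ‖z.2‖ ≤ ‖z.1‖} :=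
      isClosed_le continuous_snd.norm continuous_fst.norm
    have : (S : Set (B × D)) ⊆ {z | ‖z.2‖ ≤ ‖z.1‖} := by
      refine closure_minimal (fun z hz => ?_) hc
      obtain ⟨p, rfl⟩ := StarPoly.exists_eval_eq _ hz
      have h1 := StarPoly.map_eval (NonUnitalStarAlgHom.fst ℂ B D) (fun x => (f x, g x)) p
      have h2 := StarPoly.map_eval (NonUnitalStarAlgHom.snd ℂ B D) (fun x => (f x, g x)) p
      simp only [NonUnitalStarAlgHom.fst_apply, NonUnitalStarAlgHom.snd_apply] at h1 h2
      rw [Set.mem_ofPred_eq, h1, h2]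
      exact h p
    exact fun z hz => this hz
  let q : S →⋆ₙₐ[ℂ] B :=
    (NonUnitalStarAlgHom.fst ℂ B D).comp (NonUnitalStarSubalgebraClass.subtype S)
  have hiso : Isometry q := by
    refine AddMonoidHomClass.isometry_of_norm q fun z => ?_
    change ‖z.1.1‖ = max ‖z.1.1‖ ‖z.1.2‖
    rw [max_eq_left (hle z.1 z.2)]
  have hcl : IsClosed (NonUnitalStarAlgHom.range q : Set B) := by
    have : CompleteSpace S := hS.completeSpace_coe
    have := hiso.isClosedEmbedding.isClosed_range
    rwa [← NonUnitalStarAlgHom.coe_range] at this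
  have hsurj : Function.Surjective q := by
    intro b
    have : (⊤ : NonUnitalStarSubalgebra ℂ B) ≤ NonUnitalStarAlgHom.range q := by
      rw [← hf]
      refine NonUnitalStarSubalgebra.topologicalClosure_minimal _
        (NonUnitalStarAlgebra.adjoin_le ?_) hcl
      rintro _ ⟨x, rfl⟩
      exact ⟨⟨_, hmem x⟩, rfl⟩
    exact this (NonUnitalStarAlgebra.mem_top (x := b))
  let e : S ≃⋆ₐ[ℂ] B := StarAlgEquiv.ofBijective q ⟨hiso.injective, hsurj⟩
  refine ⟨((NonUnitalStarAlgHom.snd ℂ B D).comp (NonUnitalStarSubalgebraClass.subtype S)).comp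
    (e.symm : B →⋆ₙₐ[ℂ] S), fun x => ?_⟩
  have : e.symm (f x) = ⟨_, hmem x⟩ := by
    rw [StarAlgEquiv.symm_apply_eq]; rfl
  change (e.symm (f x)).1.2 = g x
  rw [this]

/-- Evaluation of a bounded family at an index. -/
def lpEval {I : Type*} (E : I → Type*) [∀ i, NonUnitalCStarAlgebra (E i)] (i : I) :
    lp E ∞ →⋆ₙₐ[ℂ] E i where
  toFun f := f i
  map_smul' _ _ := rfl
  map_zero' := rfl
  map_add' _ _ := rfl
  map_mul' _ _ := rfl
  map_star' _ := rfl

/-- In the C*-algebra generated by a family of its elements, that family generates. -/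
theorem exists_generating_corestriction {G : Type*} {L : Type w} [NonUnitalCStarAlgebra L]
    (f : G → L) :
    ∃ (P : Type w) (_ : NonUnitalCStarAlgebra P) (ι : P →⋆ₙₐ[ℂ] L) (k : G → P),
      (∀ x, ‖ι x‖ = ‖x‖) ∧ (∀ g, ι (k g) = f g) ∧
      (NonUnitalStarAlgebra.adjoin ℂ (Set.range k)).topologicalClosure = ⊤ := by
  let S : NonUnitalStarSubalgebra ℂ L :=
    (NonUnitalStarAlgebra.adjoin ℂ (Set.range f)).topologicalClosure
  have hS : IsClosed (S : Set L) := NonUnitalStarSubalgebra.isClosed_topologicalClosure _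
  have hmem : ∀ x, f x ∈ S := fun x =>
    NonUnitalStarSubalgebra.le_topologicalClosure _
      (NonUnitalStarAlgebra.subset_adjoin ℂ _ ⟨x, rfl⟩)
  refine ⟨S, inferInstance, NonUnitalStarSubalgebraClass.subtype S, fun g => ⟨f g, hmem g⟩,
    fun _ => rfl, fun _ => rfl, ?_⟩
  rw [eq_top_iff]
  intro x _
  -- Density inside `S` is tested in `L`: the inclusion maps the algebra generated by the
  -- corestricted family onto the one generated by `f`, whose closure is `S`.
  change x ∈ closure _
  rw [closure_subtype]
  refine closure_mono ?_ x.2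
  have := NonUnitalStarAlgHom.map_adjoin (R := ℂ) (NonUnitalStarSubalgebraClass.subtype S)
    (Set.range fun g => (⟨f g, hmem g⟩ : S))
  rw [← Set.range_comp] at this
  intro y hy
  have hy' : y ∈ NonUnitalStarSubalgebra.map (NonUnitalStarSubalgebraClass.subtype S)
      (NonUnitalStarAlgebra.adjoin ℂ (Set.range fun g => (⟨f g, hmem g⟩ : S))) := by
    rw [this]; exact hy
  obtain ⟨z, hz, rfl⟩ := hy'
  exact ⟨z, hz, rfl⟩

/-- Existence of the universal C*-algebra of a property of families of elements of C*-algebras,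
when the norms of the elements are bounded independently of the family and the property may be
checked in a separating set of quotients. -/
theorem exists_universal {G : Type w}
    (p : ∀ (D : Type w) [NonUnitalCStarAlgebra D], (G → D) → Prop) (N : G → ℝ)
    (hN : ∀ (D : Type w) [NonUnitalCStarAlgebra D] (f : G → D), p D f → ∀ g, ‖f g‖ ≤ N g)
    (hsep : ∀ (L : Type w) [NonUnitalCStarAlgebra L] (f : G → L),
      (∀ x : L, x ≠ 0 → ∃ (D : Type w) (_ : NonUnitalCStarAlgebra D) (ρ : L →⋆ₙₐ[ℂ] D),
        p D (fun g => ρ (f g)) ∧ ρ x ≠ 0) → p L f) :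
    ∃ (P : Type w) (_ : NonUnitalCStarAlgebra P) (f : G → P), p P f ∧
      (NonUnitalStarAlgebra.adjoin ℂ (Set.range f)).topologicalClosure = ⊤ ∧
      ∀ (D : Type w) [NonUnitalCStarAlgebra D] (k : G → D), p D k →
        ∃ ρ : P →⋆ₙₐ[ℂ] D, ∀ g, ρ (f g) = k g := by
  -- families are recorded by the norms of the values of all polynomials
  let I : Type w := {n : StarPoly G → ℝ // ∃ (D : Type w) (_ : NonUnitalCStarAlgebra D)
    (k : G → D), p D k ∧ ∀ e : StarPoly G, n e = ‖e.eval k‖}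
  choose E instE k hk hnorm using fun i : I => i.2
  let F : G → lp E ∞ := fun g => ⟨fun i => k i g, memℓp_infty ⟨N g, by
    rintro _ ⟨i, rfl⟩
    exact hN _ _ (hk i) g⟩⟩
  obtain ⟨P, instP, ι, f, hι, hf, hgen⟩ := exists_generating_corestriction F
  have hρ : ∀ i g, ((lpEval E i).comp ι) (f g) = k i g := fun i g => by
    change (ι (f g)) i = _
    rw [hf]
  refine ⟨P, instP, f, ?_, hgen, ?_⟩
  · refine hsep P f fun x hx => ?_
    have hx' : ι x ≠ 0 := fun h0 => hx (norm_eq_zero.1 (by rw [← hι, h0, norm_zero]))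
    obtain ⟨i, hi⟩ : ∃ i, (ι x) i ≠ 0 := by
      by_contra! hcon
      exact hx' (lp.ext (funext hcon))
    refine ⟨E i, instE i, (lpEval E i).comp ι, ?_, hi⟩
    simp only [hρ]
    exact hk i
  · intro D _ k' hk'
    -- The algebra `E i` chosen for this index need not be `D`. Only the norms of all polynomials
    -- agree, and that is enough for the comparison.
    let i : I := ⟨fun e => ‖e.eval k'‖, D, _, k', hk', fun _ => rfl⟩
    refine exists_starHom_of_norm_eval_le f k' hgen fun e => ?_
    have h1 : ‖e.eval k'‖ = ‖e.eval (k i)‖ := hnorm i e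
    have h2 := StarPoly.map_eval ((lpEval E i).comp ι) f e
    simp only [hρ] at h2
    rw [h1, ← h2]
    exact NonUnitalStarAlgHom.norm_apply_le _ _

theorem starHom_continuous {B D : Type*} [NonUnitalCStarAlgebra B] [NonUnitalCStarAlgebra D]
    (ρ : B →⋆ₙₐ[ℂ] D) : Continuous ρ :=
  AddMonoidHomClass.continuous_of_bound ρ 1 fun x => by
    simpa using NonUnitalStarAlgHom.norm_apply_le ρ x

theorem starHom_eq_of_eqOn_generators {B D : Type*} [NonUnitalCStarAlgebra B]
    [NonUnitalCStarAlgebra D] {s : Set B}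
    (hs : (NonUnitalStarAlgebra.adjoin ℂ s).topologicalClosure = ⊤) (ρ σ : B →⋆ₙₐ[ℂ] D)
    (h : Set.EqOn ρ σ s) : ρ = σ := by
  have hle : (⊤ : NonUnitalStarSubalgebra ℂ B) ≤ NonUnitalStarAlgHom.equalizer ρ σ := by
    rw [← hs]
    exact NonUnitalStarSubalgebra.topologicalClosure_minimal _
      (NonUnitalStarAlgebra.adjoin_le fun x hx => h hx)
      (isClosed_eq (starHom_continuous ρ) (starHom_continuous σ))
  ext x
  exact hle (NonUnitalStarAlgebra.mem_top (x := x))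

/-! ### The left action of a C*-correspondence -/

section Correspondence

variable {A : Type u} {X : Type v} [NonUnitalCStarAlgebra A] [PartialOrder A] [StarOrderedRing A]
  [NormedAddCommGroup X] [NormedSpace ℂ X] [SMul Aᵐᵒᵖ X] [CStarModule Aᵐᵒᵖ X]

theorem rinner_self_nonneg (ξ : X) : 0 ≤ rinner A ξ ξ := by
  have h : (0 : Aᵐᵒᵖ) ≤ inner Aᵐᵒᵖ ξ ξ := CStarModule.inner_self_nonneg
  exact h

theorem rinner_sub (ξ η ζ : X) : rinner A ξ (η - ζ) = rinner A ξ η - rinner A ξ ζ := by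
  simp [rinner]

theorem rinner_sub_left (ξ η ζ : X) : rinner A (ξ - η) ζ = rinner A ξ ζ - rinner A η ζ := by
  simp [rinner]

/-- For selfadjoint `e` with `‖e‖ ≤ 1`, there is `d` with `1 - e = (1 - d)²`. -/
theorem exists_isSelfAdjoint_add_sub_mul_self {e : A} (he : IsSelfAdjoint e) (h1 : ‖e‖ ≤ 1) :
    ∃ d : A, IsSelfAdjoint d ∧ d + d - d * d = e := by
  -- Solves $1-(1-f)^2=x$ for $x\le 1$; since $f(0)=0$, the non-unital functional calculus applies
  -- and `d` stays in `A`.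
  let f : ℝ → ℝ := fun x => 1 - √(1 - x)
  have hf : Continuous f := by fun_prop
  have hf0 : f 0 = 0 := by simp [f]
  refine ⟨cfcₙ f e, IsSelfAdjoint.cfcₙ, ?_⟩
  rw [← cfcₙ_add f f e, ← cfcₙ_mul f f e, ← cfcₙ_sub _ _ e]
  conv_rhs => rw [← cfcₙ_id' ℝ e]
  refine cfcₙ_congr fun x hx => ?_
  have hx1 : x ≤ 1 := (le_abs_self x).trans
    ((NonUnitalIsometricContinuousFunctionalCalculus.norm_quasispectrum_le e hx he).trans h1)
  have := Real.mul_self_sqrt (sub_nonneg.2 hx1)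
  simp only [f]
  linarith

namespace Correspondence

variable (C : Correspondence A X)

theorem rinner_φ_self (a : A) (ξ : X) :
    rinner A (C.φ a ξ) (C.φ a ξ) = rinner A ξ (C.φ (star a * a) ξ) := by
  rw [C.adjoint, map_mul]; rfl

/-- Writing $1-a^*a=(1-d)^2$ formally,
$\langle\xi,\xi\rangle-\langle\varphi(a)\xi,\varphi(a)\xi\rangle$ is the inner square of
$\xi-\varphi(d)\xi$, hence positive. -/
theorem norm_φ_apply_le_of_norm_le_one {a : A} (ha : ‖a‖ ≤ 1) (ξ : X) : ‖C.φ a ξ‖ ≤ ‖ξ‖ := by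
  obtain ⟨d, hd, hde⟩ := exists_isSelfAdjoint_add_sub_mul_self (IsSelfAdjoint.star_mul_self a)
    (by rw [CStarRing.norm_star_mul_self]; exact mul_le_one₀ ha (norm_nonneg _) ha)
  have key : rinner A ξ ξ - rinner A (C.φ a ξ) (C.φ a ξ) =
      rinner A (ξ - C.φ d ξ) (ξ - C.φ d ξ) := by
    rw [rinner_φ_self, ← hde, rinner_sub, rinner_sub_left, rinner_sub_left, rinner_φ_self,
      C.adjoint, hd.star_eq, map_sub, map_add, sub_apply, add_apply, rinner_sub, rinner_add]
    abel
  have hle : rinner A (C.φ a ξ) (C.φ a ξ) ≤ rinner A ξ ξ := by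
    rw [← sub_nonneg, key]; exact rinner_self_nonneg _
  have hn := CStarAlgebra.norm_le_norm_of_nonneg_of_le (rinner_self_nonneg _) hle
  rw [← norm_sq_eq, ← norm_sq_eq] at hn
  exact (pow_le_pow_iff_left₀ (norm_nonneg _) (norm_nonneg _) two_ne_zero).1 hn

theorem norm_φ_le (a : A) : ‖C.φ a‖ ≤ ‖a‖ := by
  refine ContinuousLinearMap.opNorm_le_bound _ (norm_nonneg _) fun ξ => ?_
  rcases eq_or_ne a 0 with rfl | ha
  · simp
  have ha' : 0 < ‖a‖ := norm_pos_iff.2 ha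
  have h := C.norm_φ_apply_le_of_norm_le_one (a := ((‖a‖⁻¹ : ℝ) : ℂ) • a)
    (by rw [norm_smul, Complex.norm_real, norm_inv, norm_norm, inv_mul_cancel₀ ha'.ne']) ξ
  rwa [map_smul, smul_apply, norm_smul, Complex.norm_real, norm_inv, norm_norm,
    inv_mul_le_iff₀ ha'] at h

/-- The left action as a continuous linear map. -/
noncomputable def φL : A →L[ℂ] (X →L[ℂ] X) :=
  LinearMap.mkContinuous (C.φ : A →ₗ[ℂ] (X →L[ℂ] X)) 1 fun a => by
    simpa using C.norm_φ_le a

theorem norm_φ_star_le (a : A) : ‖C.φ (star a)‖ ≤ ‖C.φ a‖ := by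
  refine ContinuousLinearMap.opNorm_le_bound _ (norm_nonneg _) fun ξ => ?_
  rcases (norm_nonneg (C.φ (star a) ξ)).eq_or_lt with h0 | h0
  · rw [← h0]; positivity
  have h1 : ‖C.φ (star a) ξ‖ * ‖C.φ (star a) ξ‖ ≤ (‖C.φ a‖ * ‖ξ‖) * ‖C.φ (star a) ξ‖ := by
    rw [← sq, norm_sq_eq (A := A), C.adjoint, star_star]
    calc ‖rinner A ξ (C.φ a (C.φ (star a) ξ))‖
        ≤ ‖ξ‖ * (‖C.φ a‖ * ‖C.φ (star a) ξ‖) :=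
          (norm_rinner_le _ _).trans (by gcongr; exact (C.φ a).le_opNorm _)
      _ = _ := by ring
  exact le_of_mul_le_mul_right h1 h0

theorem φ_star_eq_zero {a : A} (h : C.φ a = 0) : C.φ (star a) = 0 := by
  have := C.norm_φ_star_le a
  rw [h, norm_zero] at this
  exact norm_le_zero_iff.1 this

/-- The kernel is stable under `star`, so $a$ annihilates $a^*$ and $aa^*=0$. -/
theorem eq_zero_of_mem_perp {a : A} (h : a ∈ perp {b | C.φ b = 0}) (h0 : C.φ a = 0) : a = 0 :=
  (CStarRing.mul_star_self_eq_zero_iff a).1 (h _ (C.φ_star_eq_zero h0))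

end Correspondence

theorem isClosed_perp (I : Set A) : IsClosed (perp I) := by
  have : perp I = ⋂ b ∈ I, {a | a * b = 0} := by ext; simp [perp]
  rw [this]
  exact isClosed_biInter fun b _ => isClosed_eq (continuous_mul_const b) continuous_const

theorem isClosed_compacts : IsClosed (compacts A X : Set (X →L[ℂ] X)) :=
  Submodule.isClosed_topologicalClosure _

theorem Correspondence.isClosed_J (C : Correspondence A X) : IsClosed C.J :=
  (isClosed_compacts.preimage C.φL.continuous).inter (isClosed_perp _)

/-- If `‖b c‖` is controlled by `‖φ(b)‖` for all `b`, then `‖c‖ ≤ ‖φ(c)‖`. -/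
theorem Correspondence.norm_le_norm_φ_of_bound (C : Correspondence A X) {c : A} {K : ℝ}
    (hK0 : 0 ≤ K) (hK : ∀ b : A, ‖b * c‖ ≤ ‖C.φ b‖ * K) : ‖c‖ ≤ ‖C.φ c‖ := by
  -- Spectral radius argument: for $b=h^{2^k}$ selfadjointness gives $\|b\|=\|h\|^{2^k}$, while
  -- $\|\varphi(b)\|\le\|\varphi(h)\|^{2^k}$. Comparing growth rates as $k\to\infty$ removes the
  -- constant `K`.
  set h : A := c * star c with hh
  have hn : ‖h‖ = ‖c‖ ^ 2 := by rw [hh, CStarRing.norm_self_mul_star, sq]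
  have hφh : ‖C.φ h‖ ≤ ‖C.φ c‖ ^ 2 := by
    rw [hh, map_mul, sq]
    exact (norm_mul_le _ _).trans (by gcongr; exact C.norm_φ_star_le c)
  -- `b` stands for `h ^ 2 ^ k = c y`
  have pow : ∀ k : ℕ, ∃ b y : A, IsSelfAdjoint b ∧ b = c * y ∧ ‖b‖ = ‖h‖ ^ 2 ^ k ∧
      ‖C.φ b‖ ≤ ‖C.φ h‖ ^ 2 ^ k ∧ ‖y‖ * ‖h‖ ≤ ‖c‖ * ‖h‖ ^ 2 ^ k := by
    intro k
    induction k with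
    | zero =>
      exact ⟨h, star c, .mul_star_self c, rfl, by simp, by simp, by simp⟩
    | succ k ih =>
      obtain ⟨b, y, hb, hby, h1, h2, h3⟩ := ih
      refine ⟨b * b, y * b, ?_, ?_, ?_, ?_, ?_⟩
      · have := IsSelfAdjoint.star_mul_self b
        rwa [hb.star_eq] at this
      · rw [← mul_assoc, ← hby]
      · rw [hb.norm_mul_self, h1, pow_succ 2 k, pow_mul]
      · rw [map_mul, pow_succ 2 k, pow_mul, sq]
        exact (norm_mul_le _ _).trans (by gcongr)
      · calc ‖y * b‖ * ‖h‖ ≤ ‖y‖ * ‖b‖ * ‖h‖ := by gcongr; exact norm_mul_le _ _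
          _ = ‖y‖ * ‖h‖ * ‖h‖ ^ 2 ^ k := by rw [h1]; ring
          _ ≤ ‖c‖ * ‖h‖ ^ 2 ^ k * ‖h‖ ^ 2 ^ k := by gcongr
          _ = _ := by rw [pow_succ 2 k, pow_mul, sq, mul_assoc]
  by_contra! hlt
  have hc : 0 < ‖c‖ := (norm_nonneg _).trans_lt hlt
  have hpos : 0 < ‖h‖ := by rw [hn]; positivity
  have hlt' : ‖C.φ h‖ < ‖h‖ := hφh.trans_lt (by rw [hn]; gcongr)
  -- Since $b^2=(bc)y$, the hypothesis is used only once for each $k$, so `K` enters to the first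
  -- power. The bound on $\|y\|\,\|h\|$ stands for $\|y\|\le\|c\|\,\|h\|^{2^k-1}$.
  have key : ∀ k : ℕ, ‖h‖ ≤ K * ‖c‖ * (‖C.φ h‖ / ‖h‖) ^ 2 ^ k := fun k => by
    obtain ⟨b, y, hb, hby, h1, h2, h3⟩ := pow k
    have h4 : ‖b * b‖ ≤ ‖C.φ h‖ ^ 2 ^ k * K * ‖y‖ := by
      conv_lhs => rw [hby, ← mul_assoc, ← hby]
      exact (norm_mul_le _ _).trans (by gcongr; exact (hK b).trans (by gcongr))
    rw [hb.norm_mul_self, h1] at h4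
    rw [div_pow, ← mul_div_assoc, le_div_iff₀ (by positivity)]
    refine le_of_mul_le_mul_right ?_ (pow_pos hpos (2 ^ k))
    calc ‖h‖ * ‖h‖ ^ 2 ^ k * ‖h‖ ^ 2 ^ k = (‖h‖ ^ 2 ^ k) ^ 2 * ‖h‖ := by ring
      _ ≤ ‖C.φ h‖ ^ 2 ^ k * K * ‖y‖ * ‖h‖ := by gcongr
      _ = ‖C.φ h‖ ^ 2 ^ k * K * (‖y‖ * ‖h‖) := by ring
      _ ≤ ‖C.φ h‖ ^ 2 ^ k * K * (‖c‖ * ‖h‖ ^ 2 ^ k) := by gcongr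
      _ = _ := by ring
  have hlim : Filter.Tendsto (fun k : ℕ => K * ‖c‖ * (‖C.φ h‖ / ‖h‖) ^ 2 ^ k)
      Filter.atTop (nhds (K * ‖c‖ * 0)) := by
    refine Filter.Tendsto.const_mul _ ((tendsto_pow_atTop_nhds_zero_of_lt_one (by positivity)
      ((div_lt_one hpos).2 hlt')).comp ?_)
    exact Filter.tendsto_atTop_mono (fun k => Nat.lt_two_pow_self.le) Filter.tendsto_id
  have := ge_of_tendsto' hlim key
  rw [mul_zero] at this
  exact absurd this (not_le.2 hpos)

end Correspondence

/-! ### Hilbert bimodules -/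

section Bimodule

variable {A : Type u} {X : Type v} [NonUnitalCStarAlgebra A] [PartialOrder A] [StarOrderedRing A]
  [NormedAddCommGroup X] [NormedSpace ℂ X] [SMul Aᵐᵒᵖ X] [CStarModule Aᵐᵒᵖ X]

namespace Bimodule

variable (H : Bimodule A X)

/-- The link between $I_X$ and $\mathcal K(X)$ on which the comparison with $J_X$ rests. -/
theorem φ_linner (ξ η : X) : H.φ (H.linner ξ η) = theta A ξ η := by
  ext ζ; exact H.compat ξ η ζ

/-- The left inner product as a linear map in its first variable. -/
def linnerₗ (η : X) : X →ₗ[ℂ] A where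
  toFun ξ := H.linner ξ η
  map_add' ξ ζ := H.linner_add ξ ζ η
  map_smul' c ξ := H.linner_smul c ξ η

/-- Left linearity only handles factors on the left, whereas `perp` multiplies on the right; so the
adjoint is taken, using that $\varphi(b)=0$ forces $\varphi(b^*)=0$. -/
theorem linner_mem_perp (ξ η : X) : H.linner ξ η ∈ perp {b | H.φ b = 0} := by
  intro b hb
  have h0 : H.linner (H.φ (star b) η) ξ = 0 := by
    rw [H.toCorrespondence.φ_star_eq_zero hb]
    exact (H.linnerₗ ξ).map_zero
  rw [← star_eq_zero, star_mul, ← H.star_linner, ← H.linner_act, h0]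

theorem linner_mem_J (ξ η : X) : H.linner ξ η ∈ H.toCorrespondence.J :=
  ⟨by rw [Set.mem_ofPred_eq, φ_linner]; exact theta_mem_compacts ξ η, H.linner_mem_perp ξ η⟩

/-- The closed linear span of the values of the left inner product, as a submodule. -/
def ISubmodule : Submodule ℂ A :=
  (Submodule.span ℂ (Set.range fun p : X × X => H.linner p.1 p.2)).topologicalClosure

theorem linner_mem_ISubmodule (ξ η : X) : H.linner ξ η ∈ H.ISubmodule :=
  Submodule.le_topologicalClosure _ (Submodule.subset_span ⟨(ξ, η), rfl⟩)

/-- A closed submodule containing the left inner products contains `I_X`. -/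
theorem ISubmodule_le {M : Submodule ℂ A} (hM : IsClosed (M : Set A))
    (h : ∀ ξ η, H.linner ξ η ∈ M) : H.ISubmodule ≤ M :=
  Submodule.topologicalClosure_minimal _
    (Submodule.span_le.2 (by rintro _ ⟨p, rfl⟩; exact h p.1 p.2)) hM

/-- The ideal `J_X` as a submodule. -/
def JSubmodule : Submodule ℂ A where
  carrier := H.toCorrespondence.J
  zero_mem' := ⟨by simp, fun b _ => zero_mul b⟩
  add_mem' {a b} ha hb := ⟨by
    rw [Set.mem_ofPred_eq, map_add]
    exact Submodule.add_mem _ ha.1 hb.1, fun x hx => by rw [add_mul, ha.2 x hx, hb.2 x hx, add_zero]⟩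
  smul_mem' c a ha := ⟨by
    rw [Set.mem_ofPred_eq, map_smul]
    exact Submodule.smul_mem _ c ha.1, fun x hx => by rw [smul_mul_assoc, ha.2 x hx, smul_zero]⟩

theorem ISubmodule_le_JSubmodule : H.ISubmodule ≤ H.JSubmodule :=
  H.ISubmodule_le H.toCorrespondence.isClosed_J H.linner_mem_J

variable [CompleteSpace X]

/-- The left inner product is separately continuous, by the closed graph theorem. -/
theorem continuous_linnerₗ (η : X) : Continuous (H.linnerₗ η) := by
  refine LinearMap.continuous_of_seq_closed_graph _ fun s ξ a hs ha => ?_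
  -- On $(\ker\varphi)^\perp$ the map $\varphi$ is injective, so the two candidate limits may be
  -- compared after applying $\varphi$; there $\theta_{s_n,\eta}\zeta\to\theta_{\xi,\eta}\zeta$ for
  -- each $\zeta$.
  have hperp : a - H.linner ξ η ∈ perp {b | H.φ b = 0} := by
    refine (isClosed_perp _).mem_of_tendsto (ha.sub_const _) (.of_forall fun n b hb => ?_)
    change (H.linner (s n) η - H.linner ξ η) * b = 0
    rw [sub_mul, H.linner_mem_perp _ _ b hb, H.linner_mem_perp _ _ b hb, sub_zero]
  refine sub_eq_zero.1 (H.toCorrespondence.eq_zero_of_mem_perp hperp ?_)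
  rw [map_sub, sub_eq_zero]
  refine Eq.trans ?_ (H.φ_linner ξ η).symm
  ext ζ
  have h1 : Filter.Tendsto (fun n => H.φ (H.linner (s n) η) ζ) Filter.atTop
      (nhds (H.φ a ζ)) :=
    ((ContinuousLinearMap.apply ℂ X ζ).continuous.comp
      H.toCorrespondence.φL.continuous).continuousAt.tendsto.comp ha
  have h2 : Filter.Tendsto (fun n => H.φ (H.linner (s n) η) ζ) Filter.atTop
      (nhds (theta A ξ η ζ)) := by
    simp only [H.compat, theta_apply]
    have hb : Filter.Tendsto (fun n => ‖s n - ξ‖ * ‖rinner A η ζ‖) Filter.atTop (nhds 0) := by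
      have := (tendsto_iff_norm_sub_tendsto_zero.1 hs).mul_const ‖rinner A η ζ‖
      rwa [zero_mul] at this
    refine tendsto_iff_norm_sub_tendsto_zero.2
      (squeeze_zero (fun _ => norm_nonneg _) (fun n => ?_) hb)
    have : ract (s n) (rinner A η ζ) - ract ξ (rinner A η ζ) =
        ract (s n - ξ) (rinner A η ζ) := by
      refine ext_rinner A fun x => ?_
      rw [rinner_sub, rinner_ract, rinner_ract, rinner_ract, rinner_sub, sub_mul]
    rw [this]
    exact norm_ract_le _ _
  exact tendsto_nhds_unique h1 h2

/-- Because $b\,{}_X\langle\xi,\eta\rangle={}_X\langle\varphi(b)\xi,\eta\rangle$, continuity in the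
first variable bounds the product by $\|\varphi(b)\|$. The constant depends on `c`, hence the span
and not its closure. -/
theorem exists_bound_of_mem_span {c : A}
    (hc : c ∈ Submodule.span ℂ (Set.range fun p : X × X => H.linner p.1 p.2)) :
    ∃ K : ℝ, 0 ≤ K ∧ ∀ b : A, ‖b * c‖ ≤ ‖H.φ b‖ * K := by
  induction hc using Submodule.span_induction with
  | mem c hc =>
    obtain ⟨⟨ξ, η⟩, rfl⟩ := hc
    let T : X →L[ℂ] A := ⟨H.linnerₗ η, H.continuous_linnerₗ η⟩
    refine ⟨‖T‖ * ‖ξ‖, by positivity, fun b => ?_⟩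
    rw [← H.linner_act]
    calc ‖T (H.φ b ξ)‖ ≤ ‖T‖ * (‖H.φ b‖ * ‖ξ‖) :=
          (T.le_opNorm _).trans (by gcongr; exact (H.φ b).le_opNorm _)
      _ = _ := by ring
  | zero => exact ⟨0, le_rfl, fun b => by simp⟩
  | add x y _ _ hx hy =>
    obtain ⟨K, hK, h1⟩ := hx
    obtain ⟨K', hK', h2⟩ := hy
    refine ⟨K + K', by positivity, fun b => ?_⟩
    rw [mul_add, mul_add]
    exact norm_add_le_of_le (h1 b) (h2 b)
  | smul z x _ hx =>
    obtain ⟨K, hK, h1⟩ := hx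
    refine ⟨‖z‖ * K, by positivity, fun b => ?_⟩
    rw [mul_smul_comm, norm_smul, mul_left_comm]
    gcongr
    exact h1 b

/-- The left action is bounded below, hence isometric, on `I_X`. -/
theorem norm_le_norm_φ {a : A} (ha : a ∈ H.ISubmodule) : ‖a‖ ≤ ‖H.φ a‖ := by
  have hcl : IsClosed {a : A | ‖a‖ ≤ ‖H.φ a‖} :=
    isClosed_le continuous_norm H.toCorrespondence.φL.continuous.norm
  -- The inequality to be proved no longer contains the constant, so it passes from the span to the
  -- closure.
  refine closure_minimal (fun c hc => ?_) hcl ha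
  obtain ⟨K, hK, h⟩ := H.exists_bound_of_mem_span hc
  exact H.toCorrespondence.norm_le_norm_φ_of_bound hK h

/-- Every compact operator is the left action of an element of `I_X`. -/
theorem exists_φ_eq {k : X →L[ℂ] X} (hk : k ∈ compacts A X) : ∃ a ∈ H.ISubmodule, H.φ a = k := by
  let T : H.ISubmodule →L[ℂ] (X →L[ℂ] X) := H.toCorrespondence.φL.comp H.ISubmodule.subtypeL
  have : CompleteSpace H.ISubmodule :=
    (Submodule.isClosed_topologicalClosure _).completeSpace_coe
  -- Bounded below on a complete space, $\varphi|_{I_X}$ has closed range.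
  have hT : AntilipschitzWith 1 T :=
    AddMonoidHomClass.antilipschitz_of_bound T fun a => by
      rw [NNReal.coe_one, one_mul]
      exact H.norm_le_norm_φ a.2
  have hcl : IsClosed (LinearMap.range (T : H.ISubmodule →ₗ[ℂ] (X →L[ℂ] X)) : Set (X →L[ℂ] X)) :=
    hT.isClosed_range T.uniformContinuous
  have hle : compacts A X ≤ LinearMap.range (T : H.ISubmodule →ₗ[ℂ] (X →L[ℂ] X)) := by
    refine Submodule.topologicalClosure_minimal _ (Submodule.span_le.2 ?_) hcl
    rintro _ ⟨p, rfl⟩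
    exact ⟨⟨_, H.linner_mem_ISubmodule p.1 p.2⟩, H.φ_linner p.1 p.2⟩
  obtain ⟨a, ha⟩ := hle hk
  exact ⟨a, a.2, ha⟩

theorem JSubmodule_eq_ISubmodule : H.JSubmodule = H.ISubmodule := by
  refine le_antisymm (fun a ha => ?_) H.ISubmodule_le_JSubmodule
  obtain ⟨b, hb, hab⟩ := H.exists_φ_eq ha.1
  have hsub : a - b ∈ H.JSubmodule := sub_mem ha (H.ISubmodule_le_JSubmodule hb)
  have h0 : a - b = 0 := H.toCorrespondence.eq_zero_of_mem_perp hsub.2 (by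
    rw [map_sub, hab, sub_self])
  rwa [sub_eq_zero.1 h0]

theorem J_eq_I : H.toCorrespondence.J = H.I :=
  congrArg (fun M : Submodule ℂ A => (M : Set A)) H.JSubmodule_eq_ISubmodule

/-- Compatibility with the left inner product is Condition (*). -/
theorem left_inner_iff_conditionStar {B : Type w} [NonUnitalCStarAlgebra B]
    (R : Representation H.toCorrespondence B) :
    (∀ ξ η, R.π (H.linner ξ η) = R.t ξ * star (R.t η)) ↔ R.ConditionStar := by
  have hψ : ∀ ξ η, R.psi ⟨H.φ (H.linner ξ η), (H.linner_mem_J ξ η).1⟩ =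
      R.t ξ * star (R.t η) := fun ξ η => by
    rw [← R.psi_theta]
    exact congrArg R.psi (Subtype.ext (H.φ_linner ξ η))
  refine ⟨fun h a ha => ?_, fun h ξ η => by rw [h _ (H.linner_mem_J ξ η), hψ]⟩
  -- As $\psi_t$ is defined on compact operators only, $\psi_t\circ\varphi$ makes sense on $J_X$ and
  -- not on `A`. The set `E` where it agrees with $\pi$ is closed in $J_X$, so its image is closed
  -- in `A` and contains $I_X=J_X$.
  let T : H.JSubmodule →L[ℂ] compacts A X :=
    (H.toCorrespondence.φL.comp H.JSubmodule.subtypeL).codRestrict _ fun a => a.2.1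
  let E : Submodule ℂ H.JSubmodule :=
    LinearMap.eqLocus ((R.π : A →ₗ[ℂ] B).comp H.JSubmodule.subtype)
      ((R.psi.comp T : H.JSubmodule →L[ℂ] B) : H.JSubmodule →ₗ[ℂ] B)
  have hE : IsClosed (E : Set H.JSubmodule) :=
    isClosed_eq ((starHom_continuous R.π).comp continuous_subtype_val) (R.psi.comp T).continuous
  have hJ : IsClosed (H.JSubmodule : Set A) := H.toCorrespondence.isClosed_J
  have hle : H.ISubmodule ≤ E.map H.JSubmodule.subtype := by
    refine H.ISubmodule_le ?_ fun ξ η => ?_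
    · rw [Submodule.map_coe]
      exact hJ.isClosedEmbedding_subtypeVal.isClosedMap _ hE
    · exact ⟨⟨_, H.linner_mem_J ξ η⟩, (h ξ η).trans (hψ ξ η).symm, rfl⟩
  rw [← JSubmodule_eq_ISubmodule] at hle
  obtain ⟨x, hx, rfl⟩ := hle (show a ∈ H.JSubmodule from ha)
  exact hx

end Bimodule

end Bimodule

/-! ### Existence and comparison of the universal representations -/

section Universal

variable {A : Type u} {X : Type v} [NonUnitalCStarAlgebra A] [PartialOrder A] [StarOrderedRing A]
  [NormedAddCommGroup X] [NormedSpace ℂ X] [SMul Aᵐᵒᵖ X] [CStarModule Aᵐᵒᵖ X]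

/-- A covariant representation is a representation of the underlying C*-correspondence. -/
def CovariantRepresentation.toRepresentation {H : Bimodule A X} {B : Type w}
    [NonUnitalCStarAlgebra B] (Q : CovariantRepresentation H B) :
    Representation H.toCorrespondence B where
  π := Q.π
  t := Q.t
  inner_eq ξ η := (Q.right_inner ξ η).symm
  act_eq a ξ := (Q.left_act a ξ).symm

/-- A representation of the underlying C*-correspondence that respects the left inner product is
covariant. -/
def Representation.toCovariant {H : Bimodule A X} {B : Type w} [NonUnitalCStarAlgebra B]
    (R : Representation H.toCorrespondence B)
    (h : ∀ ξ η, R.π (H.linner ξ η) = R.t ξ * star (R.t η)) : CovariantRepresentation H B where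
  π := R.π
  t := R.t
  left_act a ξ := (R.act_eq a ξ).symm
  right_act := R.t_ract
  left_inner := h
  right_inner ξ η := (R.inner_eq ξ η).symm

/-- All requirements on a covariant representation, linearity included, are equations between
$*$-polynomials in the values on $A\sqcup X$, and the norms of these values are bounded by those of
the arguments. Condition (*), which involves $\psi_t$, is not needed for the construction. -/
theorem exists_isCrossedProduct (H : Bimodule A X) :
    ∃ (P : Type (max u v)) (_ : NonUnitalCStarAlgebra P) (Q : CovariantRepresentation H P),
      Q.IsCrossedProduct := by
  obtain ⟨P, instP, f, ⟨Q, hπ, ht⟩, hgen, huniv⟩ := exists_universal (G := A ⊕ X)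
    (fun (D : Type (max u v)) _ f => ∃ S : CovariantRepresentation H D,
      (∀ a, S.π a = f (.inl a)) ∧ ∀ ξ, S.t ξ = f (.inr ξ))
    (Sum.elim (fun a => ‖a‖) (fun ξ => ‖ξ‖)) (by
      rintro D _ f ⟨S, hπ, ht⟩ (a | ξ)
      · rw [← hπ]; exact NonUnitalStarAlgHom.norm_apply_le S.π a
      · rw [← ht]; exact S.toRepresentation.norm_t_le ξ) (by
      intro L _ f hsep
      -- An equation in `L` holds once it holds under every homomorphism turning `f` into a
      -- covariant representation; each relation below is checked in this way.
      have hext : ∀ x y : L, (∀ (D : Type (max u v)) [NonUnitalCStarAlgebra D]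
          (ρ : L →⋆ₙₐ[ℂ] D) (S : CovariantRepresentation H D),
          (∀ a, ρ (f (.inl a)) = S.π a) → (∀ ξ, ρ (f (.inr ξ)) = S.t ξ) → ρ x = ρ y) → x = y := by
        intro x y h
        by_contra hne
        obtain ⟨D, _, ρ, ⟨S, hπ, ht⟩, hρ⟩ := hsep (x - y) (sub_ne_zero.2 hne)
        exact hρ (by
          rw [map_sub, h D ρ S (fun a => (hπ a).symm) (fun ξ => (ht ξ).symm), sub_self])
      let π : A →⋆ₙₐ[ℂ] L :=
        { toFun := fun a => f (.inl a)
          map_smul' := fun c a => hext _ _ fun D _ ρ S hπ ht => by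
            simp only [map_smul, hπ, MonoidHom.id_apply]
          map_zero' := hext _ _ fun D _ ρ S hπ ht => by simp only [map_zero, hπ]
          map_add' := fun a b => hext _ _ fun D _ ρ S hπ ht => by simp only [map_add, hπ]
          map_mul' := fun a b => hext _ _ fun D _ ρ S hπ ht => by simp only [map_mul, hπ]
          map_star' := fun a => hext _ _ fun D _ ρ S hπ ht => by simp only [map_star, hπ] }
      let t : X →ₗ[ℂ] L :=
        { toFun := fun ξ => f (.inr ξ)
          map_smul' := fun c ξ => hext _ _ fun D _ ρ S hπ ht => by
            simp only [map_smul, ht, RingHom.id_apply]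
          map_add' := fun ξ η => hext _ _ fun D _ ρ S hπ ht => by simp only [map_add, ht] }
      have hπf : ∀ a, π a = f (.inl a) := fun _ => rfl
      have htf : ∀ ξ, t ξ = f (.inr ξ) := fun _ => rfl
      exact ⟨{
        π := π
        t := t
        left_act := fun a ξ => hext _ _ fun D _ ρ S hπ ht => by
          simp only [hπf, htf, map_mul, hπ, ht, S.left_act]
        right_act := fun ξ a => hext _ _ fun D _ ρ S hπ ht => by
          simp only [hπf, htf, map_mul, hπ, ht, S.right_act]
        left_inner := fun ξ η => hext _ _ fun D _ ρ S hπ ht => by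
          simp only [hπf, htf, map_mul, map_star, hπ, ht, S.left_inner]
        right_inner := fun ξ η => hext _ _ fun D _ ρ S hπ ht => by
          simp only [hπf, htf, map_mul, map_star, hπ, ht, S.right_inner] },
        fun _ => rfl, fun _ => rfl⟩)
  refine ⟨P, instP, Q, ?_, fun D _ S => ?_⟩
  · have : Set.range Q.π ∪ Set.range Q.t = Set.range f := by
      rw [← Set.Sum.elim_range]
      congr 1
      ext (a | ξ)
      exacts [hπ a, ht ξ]
    rw [generated, this, hgen]
  · obtain ⟨ρ, hρ⟩ := huniv D (Sum.elim S.π S.t) ⟨S, fun _ => rfl, fun _ => rfl⟩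
    exact ⟨ρ, fun a => by rw [hπ, hρ, Sum.elim_inl], fun ξ => by rw [ht, hρ, Sum.elim_inr]⟩

theorem starHom_ext_of_generated {B : Type*} {D : Type*} [NonUnitalCStarAlgebra B]
    [NonUnitalCStarAlgebra D] {π : A →⋆ₙₐ[ℂ] B} {t : X →ₗ[ℂ] B} (h : generated π t = ⊤)
    {ρ σ : B →⋆ₙₐ[ℂ] D} (hπ : ∀ a, ρ (π a) = σ (π a)) (ht : ∀ ξ, ρ (t ξ) = σ (t ξ)) : ρ = σ := by
  refine starHom_eq_of_eqOn_generators h ρ σ ?_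
  rintro _ (⟨a, rfl⟩ | ⟨ξ, rfl⟩)
  exacts [hπ a, ht ξ]

/-- Uniqueness of the C*-algebra `O_X`. -/
theorem Representation.IsCuntzPimsner.existsUnique_equiv {C : Correspondence A X}
    {P O : Type w} [NonUnitalCStarAlgebra P] [NonUnitalCStarAlgebra O]
    {Q : Representation C P} {R : Representation C O} (hQ : Q.IsCuntzPimsner)
    (hR : R.IsCuntzPimsner) :
    ∃! Φ : P ≃⋆ₐ[ℂ] O, (∀ a, Φ (Q.π a) = R.π a) ∧ ∀ ξ, Φ (Q.t ξ) = R.t ξ := by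
  obtain ⟨ρ, hρπ, hρt⟩ := hQ.universal O R hR.conditionStar
  obtain ⟨σ, hσπ, hσt⟩ := hR.universal P Q hQ.conditionStar
  have h1 : σ.comp ρ = NonUnitalStarAlgHom.id ℂ P :=
    starHom_ext_of_generated hQ.generated_eq_top (fun a => by simp [hρπ, hσπ])
      (fun ξ => by simp [hρt, hσt])
  have h2 : ρ.comp σ = NonUnitalStarAlgHom.id ℂ O :=
    starHom_ext_of_generated hR.generated_eq_top (fun a => by simp [hρπ, hσπ])
      (fun ξ => by simp [hρt, hσt])
  have hbij : Function.Bijective ρ :=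
    Function.bijective_iff_has_inverse.2 ⟨σ, DFunLike.congr_fun h1, DFunLike.congr_fun h2⟩
  refine ⟨StarAlgEquiv.ofBijective ρ hbij, ⟨hρπ, hρt⟩, ?_⟩
  rintro Φ ⟨hΦπ, hΦt⟩
  have h3 : (Φ : P →⋆ₙₐ[ℂ] O) = ρ :=
    starHom_ext_of_generated hQ.generated_eq_top (fun a => (hΦπ a).trans (hρπ a).symm)
      (fun ξ => (hΦt ξ).trans (hρt ξ).symm)
  ext x
  exact DFunLike.congr_fun h3 x

variable [CompleteSpace X]

theorem CovariantRepresentation.conditionStar {H : Bimodule A X} {B : Type w}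
    [NonUnitalCStarAlgebra B] (Q : CovariantRepresentation H B) :
    Q.toRepresentation.ConditionStar :=
  (H.left_inner_iff_conditionStar Q.toRepresentation).1 Q.left_inner

/-- Both universal properties range over the same pairs $(\pi,t)$, so the crossed product is itself
a model of $\mathcal O_X$, and the canonical isomorphism is the uniqueness of such models. -/
theorem CovariantRepresentation.IsCrossedProduct.isCuntzPimsner {H : Bimodule A X} {B : Type w}
    [NonUnitalCStarAlgebra B] {Q : CovariantRepresentation H B} (hQ : Q.IsCrossedProduct) :
    Q.toRepresentation.IsCuntzPimsner where
  conditionStar := Q.conditionStar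
  generated_eq_top := hQ.generated_eq_top
  universal D _ S hS :=
    hQ.universal D (S.toCovariant ((H.left_inner_iff_conditionStar S).2 hS))

end Universal

end HilbertBimod

open HilbertBimod in
theorem mainTheorem2 {A : Type u} {X : Type v} [NonUnitalCStarAlgebra A] [PartialOrder A]
    [StarOrderedRing A] [NormedAddCommGroup X] [NormedSpace ℂ X] [CompleteSpace X]
    [SMul Aᵐᵒᵖ X] [CStarModule Aᵐᵒᵖ X] (H : Bimodule A X) :
    -- the crossed product of `A` by `X` exists
    (∃ (P : Type (max u v)) (_ : NonUnitalCStarAlgebra P) (Q : CovariantRepresentation H P),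
      Q.IsCrossedProduct) ∧
    -- the algebra `O_X` exists
    (∃ (O : Type (max u v)) (_ : NonUnitalCStarAlgebra O)
      (R : Representation H.toCorrespondence O), R.IsCuntzPimsner) ∧
    -- they are canonically isomorphic
    (∀ (P : Type (max u v)) [NonUnitalCStarAlgebra P] (Q : CovariantRepresentation H P)
      (O : Type (max u v)) [NonUnitalCStarAlgebra O] (R : Representation H.toCorrespondence O),
      Q.IsCrossedProduct → R.IsCuntzPimsner →
        ∃! Φ : P ≃⋆ₐ[ℂ] O, (∀ a, Φ (Q.π a) = R.π a) ∧ ∀ ξ, Φ (Q.t ξ) = R.t ξ) ∧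
    -- `J_X = I_X`
    H.toCorrespondence.J = H.I ∧
    -- covariance with respect to the left inner product is Condition (*)
    (∀ (B : Type w) [NonUnitalCStarAlgebra B] (R : Representation H.toCorrespondence B),
      (∀ ξ η, R.π (H.linner ξ η) = R.t ξ * star (R.t η)) ↔ R.ConditionStar) := by
  obtain ⟨P, instP, Q, hQ⟩ := exists_isCrossedProduct H
  exact ⟨⟨P, instP, Q, hQ⟩, ⟨P, instP, Q.toRepresentation, hQ.isCuntzPimsner⟩,
    fun P _ Q O _ R hQ hR => hQ.isCuntzPimsner.existsUnique_equiv hR, H.J_eq_I,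
    fun B _ R => H.left_inner_iff_conditionStar R⟩
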